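/- Let $\mathbb F\in\{\mathbb R,\mathbb C\}$. For integers $b,N\ge 1$ with $b\mid N$ and $1<b<N$, let $\mathcal{BD}^{(b,N)}$ be the set of $N\times N$ matrices over $\mathbb F$ that are block diagonal with $N/b$ arbitrary diagonal blocks of size $b\times b$, and let $\mathcal{DB}^{(b,N)}$ be the set of $N\times N$ matrices consisting of $(N/b)\times(N/b)$ blocks, each of which is an arbitrary diagonal $b\times b$ matrix. Let $$\mathcal M^{(b,N)}=\{LR: L\in\mathcal{DB}^{(b,N)},\ R\in\mathcal{BD}^{(b,N)}\},\qquad \mathcal{MM}^{*(b,N)}=\{M_1M_2^*: M_1,M_2\in\mathcal M^{(b,N)}\},$$ where $^*$ is the conjugate transpose. For integers $w\ge 0$, $e\ge 1$, and $b\mid n$ with $1<b<n$, let $(\mathcal{MM}^{*(b,n)})^w_e$ be the set of $n\times n$ matrices that are the upper left $n\times n$ corner of a product of $w$ matrices from $\mathcal{MM}^{*(b,en)}$ (the empty product being the identity). A linear arithmetic circuit over $\mathbb F$ with $n$ inputs is a directed acyclic graph whose gates are $n$ input gates and gates that compute a linear combination $\alpha x+\beta y$ ($\alpha,\beta\in\mathbb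 F$ fixed) of the values $x,y$ of two (not necessarily distinct) previous gates, with arbitrary fan-out; each output is the value of some gate. Its total number of gates includes the input gates, and its depth is the length of the longest path from an input to an output. **Theorem (Monarch hierarchy expressivity).** There is an absolute constant $K$ such that the following holds for $\mathbb F=\mathbb R$ and $\mathbb F=\mathbb C$. Let $M\in\mathbb F^{n\times n}$ be such that the map $v\mapsto Mv$ is computed by a linear arithmetic circuit over $\mathbb F$ of depth at most $d$, where $d\ge 1$, with at most $s$ gates in total, and let $b$ be a power of $2$ with $1<b<n$ and $b\mid n$. Then there are integers $w\le K d$ and $1\le e\le K\, s/n$ with $$M\in(\mathcal{MM}^{*(b,n)})^{w}_{e}.$$ In short, $M\in(\mathcal{MM}^{*(b,n)})^{O(d)}_{O(s/n)}$. -/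

import Mathlib

open scoped Matrix

/-- A linear arithmetic circuit over `𝕜` with `n` inputs and `m` outputs. Its gates, listed in a
topological order, are numbered `0, …, n + inner - 1`: gates `0, …, n - 1` are the input gates, and
gate `n + k` computes `leftCoeff k * (gate left k) + rightCoeff k * (gate right k)`, where both
operands come earlier in the order. Gates may have arbitrary fan-out. An addition gate has both
coefficients `1`, a scalar multiplication gate has one coefficient `0`. Every output is the value of
some gate. -/
structure LinearCircuit (𝕜 : Type*) (n m : ℕ) where
  /-- the number of gates other than the input gates -/
  inner : ℕ
  left : Fin inner → ℕ
  right : Fin inner → ℕ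
  leftCoeff : Fin inner → 𝕜
  rightCoeff : Fin inner → 𝕜
  left_lt : ∀ k : Fin inner, left k < n + k
  right_lt : ∀ k : Fin inner, right k < n + k
  out : Fin m → Fin (n + inner)

namespace LinearCircuit

variable {𝕜 : Type*} {n m : ℕ}

/-- The total number of gates; the `n` input gates are counted. -/
def size (C : LinearCircuit 𝕜 n m) : ℕ := n + C.inner

/-- The value of gate `i` on the input vector `v`. -/
def gateVal [Semiring 𝕜] (C : LinearCircuit 𝕜 n m) (v : Fin n → 𝕜) (i : Fin (n + C.inner)) : 𝕜 :=
  if h : (i : ℕ) < n then v ⟨i, h⟩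
  else
    have hk : (i : ℕ) - n < C.inner := by have := i.isLt; omega
    have hl := C.left_lt ⟨i - n, hk⟩
    have hr := C.right_lt ⟨i - n, hk⟩
    C.leftCoeff ⟨i - n, hk⟩ *
        C.gateVal v ⟨C.left ⟨i - n, hk⟩, by simp only at hl; omega⟩ +
      C.rightCoeff ⟨i - n, hk⟩ *
        C.gateVal v ⟨C.right ⟨i - n, hk⟩, by simp only at hr; omega⟩
termination_by (i : ℕ)
decreasing_by all_goals simp only at *; omega

/-- The length of the longest path from an input gate to gate `i`. -/
def gateDepth (C : LinearCircuit 𝕜 n m) (i : Fin (n + C.inner)) : ℕ :=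
  if h : (i : ℕ) < n then 0
  else
    have hk : (i : ℕ) - n < C.inner := by have := i.isLt; omega
    have hl := C.left_lt ⟨i - n, hk⟩
    have hr := C.right_lt ⟨i - n, hk⟩
    1 + max (C.gateDepth ⟨C.left ⟨i - n, hk⟩, by simp only at hl; omega⟩)
        (C.gateDepth ⟨C.right ⟨i - n, hk⟩, by simp only at hr; omega⟩)
termination_by (i : ℕ)
decreasing_by all_goals simp only at *; omega

/-- The depth of the circuit: the length of the longest path from an input to an output. -/
def depth (C : LinearCircuit 𝕜 n m) : ℕ := Finset.univ.sup fun j => C.gateDepth (C.out j)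

/-- The circuit computes the map `v ↦ M v`. -/
def Computes [Semiring 𝕜] (C : LinearCircuit 𝕜 n m) (M : Matrix (Fin m) (Fin n) 𝕜) : Prop :=
  ∀ v : Fin n → 𝕜, (fun j => C.gateVal v (C.out j)) = M *ᵥ v

end LinearCircuit

/-- The class `BD^(b,n)` (for `b ∣ n`): block-diagonal `n × n` matrices `diag(R_0, …, R_{n/b-1})`
with arbitrary `b × b` blocks `R_i`. With 0-based indices, entry `(i, j)` lies in the block with
block row `i / b` and block column `j / b`. -/
def blockDiagClass (𝕜 : Type*) [Zero 𝕜] (b n : ℕ) : Set (Matrix (Fin n) (Fin n) 𝕜) :=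
  {R | ∀ i j : Fin n, (i : ℕ) / b ≠ (j : ℕ) / b → R i j = 0}

/-- The class `DB^(b,n)` (for `b ∣ n`): `n × n` matrices made of `(n/b) × (n/b)` blocks, each an
arbitrary diagonal `b × b` matrix. With 0-based indices, entry `(i, j)` has position
`(i % b, j % b)` inside its block. -/
def diagBlockClass (𝕜 : Type*) [Zero 𝕜] (b n : ℕ) : Set (Matrix (Fin n) (Fin n) 𝕜) :=
  {L | ∀ i j : Fin n, (i : ℕ) % b ≠ (j : ℕ) % b → L i j = 0}

/-- The class `M^(b,n)` of Monarch matrices with block size `b`: products `L R` with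
`L ∈ DB^(b,n)` and `R ∈ BD^(b,n)`. -/
def monarchClass (𝕜 : Type*) [RCLike 𝕜] (b n : ℕ) : Set (Matrix (Fin n) (Fin n) 𝕜) :=
  {M | ∃ L ∈ diagBlockClass 𝕜 b n, ∃ R ∈ blockDiagClass 𝕜 b n, M = L * R}

/-- The class `MM^*(b,n)`: products `M₁ M₂^*` of a Monarch matrix and the conjugate transpose of a
Monarch matrix. -/
def monarchStarClass (𝕜 : Type*) [RCLike 𝕜] (b n : ℕ) : Set (Matrix (Fin n) (Fin n) 𝕜) :=
  {M | ∃ M₁ ∈ monarchClass 𝕜 b n, ∃ M₂ ∈ monarchClass 𝕜 b n, M = M₁ * M₂ᴴ}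

/-- The Monarch hierarchy `(MM^*(b,n))^w_e`, where `e ≥ 1`: upper left `n × n` corners of products
of `w` matrices from `MM^*(b, e n)`. -/
def monarchHierarchy (𝕜 : Type*) [RCLike 𝕜] (b n w e : ℕ) : Set (Matrix (Fin n) (Fin n) 𝕜) :=
  {M | ∃ he : 1 ≤ e, ∃ F : Fin w → Matrix (Fin (e * n)) (Fin (e * n)) 𝕜,
    (∀ k, F k ∈ monarchStarClass 𝕜 b (e * n)) ∧
      M = (List.ofFn F).prod.submatrix (Fin.castLE (Nat.le_mul_of_pos_left n he))
        (Fin.castLE (Nat.le_mul_of_pos_left n he))}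

/-! Picture the `N = b * p` coordinates as a grid with `b` columns (residues mod `b`) and `p` rows
(quotients by `b`). A matrix in `DB` acts within columns and one in `BD` within rows, so a factor
`D₂ * B * D₁` of `MM^*` can move data column-row-column, as in a three-stage Clos network. Any
permutation is routed by one such factor: König's theorem colours the edges "source column to target
column" with `p` colours, and the colour of an edge is the row in which its value changes column.

Copying is harder, since a gate may have arbitrary fan-out. If requests are sorted by source, equal
ones form intervals, and a single factor with one spare row spreads each value over its interval.
Thus permute, spread, permute: three factors realize any assignment.

A circuit is then simulated on all gates at once: each round fetches both operands into adjacent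
coordinates (three factors) and combines them inside `b`-blocks (one factor). After `t` rounds all
gates of depth at most `t` are correct. Loading inputs and reading outputs costs three factors each.
-/

/-! ### Edge colouring of regular bipartite multigraphs. -/

open Finset in
/-- Kőnig's edge colouring theorem for regular bipartite multigraphs: the edges `s`, with
end points `u` and `v`, admit a proper colouring with as many colours as the degree. -/
theorem exists_bipartite_edge_coloring {E C : Type*} [Fintype C] [DecidableEq C] [DecidableEq E]
    (u v : E → C) (p : ℕ) (s : Finset E) (hu : ∀ c, #{i ∈ s | u i = c} = p)
    (hv : ∀ c, #{i ∈ s | v i = c} = p) :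
    ∃ ρ : E → ℕ, (∀ i ∈ s, ρ i < p) ∧
      (∀ i ∈ s, ∀ j ∈ s, u i = u j → ρ i = ρ j → i = j) ∧
      (∀ i ∈ s, ∀ j ∈ s, v i = v j → ρ i = ρ j → i = j) := by
  induction p generalizing s with
  | zero =>
    have hs : ∀ i, i ∉ s := fun i hi => by
      have := Finset.card_eq_zero.1 (hu (u i))
      exact Finset.notMem_empty i (this ▸ Finset.mem_filter.2 ⟨hi, rfl⟩)
    exact ⟨fun _ => 0, fun i hi => absurd hi (hs i), fun i hi => absurd hi (hs i),
      fun i hi => absurd hi (hs i)⟩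
  | succ p ih =>
    have count : ∀ (w : E → C), (∀ c, #{i ∈ s | w i = c} = p + 1) → ∀ A : Finset C,
        #{i ∈ s | w i ∈ A} = #A * (p + 1) := fun w hw A => by
      rw [Finset.card_eq_sum_card_fiberwise (f := w) (t := A) (fun i hi => by simp_all)]
      rw [Finset.sum_const_nat]
      intro c hc
      rw [← hw c, Finset.filter_filter]
      congr 1
      ext i
      simp only [Finset.mem_filter]
      exact ⟨fun h => ⟨h.1, h.2.2⟩, fun h => ⟨h.1, h.2 ▸ hc, h.2⟩⟩
    -- Hall's condition by double counting: the `#A * (p + 1)` edges leaving `A` all end in its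
    -- neighbourhood. The matching `g` found here receives the last colour `p`.
    obtain ⟨m, hm, hmem⟩ := (Finset.all_card_le_biUnion_card_iff_exists_injective
      (fun c => (s.filter (u · = c)).image v)).1 (fun A => by
        have h : #{i ∈ s | u i ∈ A} ≤
            #{i ∈ s | v i ∈ A.biUnion fun c => (s.filter (u · = c)).image v} := by
          apply Finset.card_le_card
          intro i hi
          rw [Finset.mem_filter] at hi
          simp only [Finset.mem_filter, Finset.mem_biUnion, Finset.mem_image]
          exact ⟨hi.1, u i, hi.2, i, ⟨hi.1, rfl⟩, rfl⟩
        rw [count u hu, count v hv] at h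
        exact Nat.le_of_mul_le_mul_right h (Nat.succ_pos p))
    simp only [Finset.mem_image, Finset.mem_filter] at hmem
    choose g hg hgv using hmem
    have hmb : Function.Bijective m := Finite.injective_iff_bijective.1 hm
    have eu : ∀ c, {i ∈ s \ univ.image g | u i = c} = ({i ∈ s | u i = c} : Finset E).erase (g c) :=
      fun c => by
        ext i
        simp only [Finset.mem_filter, Finset.mem_sdiff, Finset.mem_image, Finset.mem_univ,
          true_and, Finset.mem_erase]
        constructor
        · rintro ⟨⟨h1, h2⟩, h3⟩
          exact ⟨fun h => h2 ⟨c, h.symm⟩, h1, h3⟩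
        · rintro ⟨h1, h2, h3⟩
          refine ⟨⟨h2, ?_⟩, h3⟩
          rintro ⟨c', rfl⟩
          exact h1 (by rw [← h3, (hg c').2])
    have ev : ∀ c, {i ∈ s \ univ.image g | v i = m c} =
        ({i ∈ s | v i = m c} : Finset E).erase (g c) := fun c => by
      ext i
      simp only [Finset.mem_filter, Finset.mem_sdiff, Finset.mem_image, Finset.mem_univ,
        true_and, Finset.mem_erase]
      constructor
      · rintro ⟨⟨h1, h2⟩, h3⟩
        exact ⟨fun h => h2 ⟨c, h.symm⟩, h1, h3⟩
      · rintro ⟨h1, h2, h3⟩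
        refine ⟨⟨h2, ?_⟩, h3⟩
        rintro ⟨c', rfl⟩
        rw [hgv c'] at h3
        exact h1 (by rw [hm h3])
    obtain ⟨ρ, hρ, hρu, hρv⟩ := ih (s \ univ.image g)
      (fun c => by
        rw [eu c, Finset.card_erase_of_mem (Finset.mem_filter.2 (hg c)), hu c]; rfl)
      (fun c => by
        obtain ⟨c, rfl⟩ := hmb.2 c
        rw [ev c, Finset.card_erase_of_mem (Finset.mem_filter.2 ⟨(hg c).1, hgv c⟩), hv]; rfl)
    have key : ∀ w : E → C, (∀ c c', w (g c) = w (g c') → c = c') →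
        (∀ i ∈ s \ univ.image g, ∀ j ∈ s \ univ.image g, w i = w j → ρ i = ρ j → i = j) →
        ∀ i ∈ s, ∀ j ∈ s, w i = w j → (if i ∈ univ.image g then p else ρ i) =
          (if j ∈ univ.image g then p else ρ j) → i = j := by
      intro w hw h i hi j hj hij hc
      by_cases h1 : i ∈ univ.image g <;> by_cases h2 : j ∈ univ.image g
      · obtain ⟨c, -, rfl⟩ := Finset.mem_image.1 h1
        obtain ⟨c', -, rfl⟩ := Finset.mem_image.1 h2
        rw [hw c c' hij]
      · have := hρ j (Finset.mem_sdiff.2 ⟨hj, h2⟩)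
        rw [if_pos h1, if_neg h2] at hc
        omega
      · have := hρ i (Finset.mem_sdiff.2 ⟨hi, h1⟩)
        rw [if_neg h1, if_pos h2] at hc
        omega
      · rw [if_neg h1, if_neg h2] at hc
        exact h i (Finset.mem_sdiff.2 ⟨hi, h1⟩) j (Finset.mem_sdiff.2 ⟨hj, h2⟩) hij hc
    refine ⟨fun i => if i ∈ univ.image g then p else ρ i, fun i hi => ?_,
      key u (fun c c' h => by rwa [(hg c).2, (hg c').2] at h) hρu,
      key v (fun c c' h => by rw [hgv c, hgv c'] at h; exact hm h) hρv⟩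
    by_cases h : i ∈ univ.image g
    · simp only [if_pos h]; omega
    · have := hρ i (Finset.mem_sdiff.2 ⟨hi, h⟩)
      simp only [if_neg h]; omega

/-! ### Routing data with Monarch factors. -/

section Monarch

variable {𝕜 : Type*} [RCLike 𝕜] {b p N m : ℕ}

/-- The class `MM^*` contains all products `D₂ * B * D₁`. -/
theorem mul_mul_mem_monarchStarClass {D₂ B D₁ : Matrix (Fin N) (Fin N) 𝕜}
    (h₂ : D₂ ∈ diagBlockClass 𝕜 b N) (hB : B ∈ blockDiagClass 𝕜 b N)
    (h₁ : D₁ ∈ diagBlockClass 𝕜 b N) : D₂ * B * D₁ ∈ monarchStarClass 𝕜 b N := by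
  refine ⟨D₂ * B, ⟨D₂, h₂, B, hB, rfl⟩, D₁ᴴ, ⟨D₁ᴴ, fun i j hij => ?_, 1, fun i j hij => ?_, ?_⟩, ?_⟩
  · rw [Matrix.conjTranspose_apply, h₁ j i (Ne.symm hij), star_zero]
  · exact Matrix.one_apply_ne fun h => hij (h ▸ rfl)
  · rw [mul_one]
  · rw [Matrix.conjTranspose_conjTranspose]

theorem one_mem_diagBlockClass : (1 : Matrix (Fin N) (Fin N) 𝕜) ∈ diagBlockClass 𝕜 b N :=
  fun _ _ hij => Matrix.one_apply_ne fun h => hij (h ▸ rfl)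

open Classical in
/-- The 0-1 matrix that moves coordinate `v k` to coordinate `u k`, for all `k`. -/
noncomputable def moveMatrix (𝕜 : Type*) [RCLike 𝕜] {ι : Type*} (u v : ι → Fin N) :
    Matrix (Fin N) (Fin N) 𝕜 :=
  fun i j => if ∃ k, u k = i ∧ v k = j then 1 else 0

theorem moveMatrix_mulVec {ι : Type*} {u v : ι → Fin N} (h : ∀ k l, u k = u l → v k = v l)
    (x : Fin N → 𝕜) (k : ι) : (moveMatrix 𝕜 u v *ᵥ x) (u k) = x (v k) := by
  classical
  rw [Matrix.mulVec, dotProduct, Finset.sum_eq_single (v k)]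
  · rw [moveMatrix, if_pos ⟨k, rfl, rfl⟩, one_mul]
  · intro j _ hj
    rw [moveMatrix, if_neg, zero_mul]
    rintro ⟨l, h1, h2⟩
    exact hj (by rw [← h2, h l k h1])
  · simp

theorem moveMatrix_mem_diagBlockClass {ι : Type*} {u v : ι → Fin N}
    (h : ∀ k, (u k : ℕ) % b = v k % b) : moveMatrix 𝕜 u v ∈ diagBlockClass 𝕜 b N := by
  intro i j hij
  rw [moveMatrix, if_neg]
  rintro ⟨k, rfl, rfl⟩
  exact hij (h k)

theorem moveMatrix_mem_blockDiagClass {ι : Type*} {u v : ι → Fin N}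
    (h : ∀ k, (u k : ℕ) / b = v k / b) : moveMatrix 𝕜 u v ∈ blockDiagClass 𝕜 b N := by
  intro i j hij
  rw [moveMatrix, if_neg]
  rintro ⟨k, rfl, rfl⟩
  exact hij (h k)

/-- A multicast can be routed by one factor as soon as every target is given a row through which
its value passes, such that no two different values meet in a cell. -/
theorem exists_monarchStar_of_route (hb : 0 < b) (hN : N = b * p) {ι : Type*}
    {q f : ι → Fin N} (ρ : ι → ℕ) (hρ : ∀ k, ρ k < p) (hq : Function.Injective q)
    (h₁ : ∀ k l, (q k : ℕ) % b = q l % b → ρ k = ρ l → f k = f l)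
    (h₂ : ∀ k l, (f k : ℕ) % b = f l % b → ρ k = ρ l → f k = f l) :
    ∃ A ∈ monarchStarClass 𝕜 b N, ∀ (x : Fin N → 𝕜) k, (A *ᵥ x) (q k) = x (f k) := by
  have lt : ∀ k (i : Fin N), b * ρ k + (i : ℕ) % b < N := fun k i => by
    have h1 := Nat.mod_lt (i : ℕ) hb
    have h2 : b * (ρ k + 1) ≤ b * p := Nat.mul_le_mul_left b (hρ k)
    rw [mul_add] at h2
    omega
  -- The grid point in row `ρ k` and the column of `i`; value `k` travels `f k`, `cell k (f k)`,
  -- `cell k (q k)`, `q k`.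
  let cell : ι → Fin N → Fin N := fun k i => ⟨b * ρ k + (i : ℕ) % b, lt k i⟩
  have cmod : ∀ k i, (cell k i : ℕ) % b = i % b := fun k i => by
    simp only [cell, Nat.mul_add_mod, Nat.mod_mod]
  have cdiv : ∀ k i, (cell k i : ℕ) / b = ρ k := fun k i => by
    simp only [cell, Nat.mul_add_div hb, Nat.div_eq_of_lt (Nat.mod_lt (i : ℕ) hb), add_zero]
  have cinj : ∀ k l i j, cell k i = cell l j → ρ k = ρ l ∧ (i : ℕ) % b = j % b :=
    fun k l i j h => ⟨by rw [← cdiv k i, h, cdiv], by rw [← cmod k i, h, cmod]⟩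
  refine ⟨_, mul_mul_mem_monarchStarClass
    (moveMatrix_mem_diagBlockClass (u := q) (v := fun k => cell k (q k)) fun k => (cmod _ _).symm)
    (moveMatrix_mem_blockDiagClass (u := fun k => cell k (q k)) (v := fun k => cell k (f k))
      fun k => by rw [cdiv, cdiv])
    (moveMatrix_mem_diagBlockClass (u := fun k => cell k (f k)) (v := f) fun k => cmod _ _),
    fun x k => ?_⟩
  rw [← Matrix.mulVec_mulVec, ← Matrix.mulVec_mulVec,
    moveMatrix_mulVec (fun k l h => by rw [hq h]),
    moveMatrix_mulVec (u := fun k => cell k (q k)) (v := fun k => cell k (f k)),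
    moveMatrix_mulVec (u := fun k => cell k (f k))]
  · intro k l h
    obtain ⟨h3, h4⟩ := cinj _ _ _ _ h
    exact h₂ k l h4 h3
  · intro k l h
    obtain ⟨h3, h4⟩ := cinj _ _ _ _ h
    simp only [cell, h₁ k l h4 h3, h3]

theorem card_filter_mod_eq (hb : 0 < b) (hN : N = b * p) (c : Fin b) :
    (Finset.univ.filter fun i : Fin N => (⟨(i : ℕ) % b, Nat.mod_lt _ hb⟩ : Fin b) = c).card = p := by
  subst hN
  refine Eq.trans ?_ (Finset.card_fin p)
  symm
  have lt : ∀ r : Fin p, b * (r : ℕ) + c < b * p := fun r => by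
    have h2 : b * ((r : ℕ) + 1) ≤ b * p := Nat.mul_le_mul_left b r.isLt
    have := c.isLt
    rw [mul_add] at h2
    omega
  refine Finset.card_bij (fun r _ => ⟨b * (r : ℕ) + c, lt r⟩) ?_ ?_ ?_
  · intro r _
    simp [Fin.ext_iff, Nat.mod_eq_of_lt c.isLt]
  · intro r _ r' _ h
    simp only [Fin.mk.injEq, add_left_inj] at h
    exact Fin.ext (Nat.eq_of_mul_eq_mul_left hb h)
  · intro i hi
    simp only [Finset.mem_filter, Finset.mem_univ, true_and, Fin.ext_iff] at hi
    refine ⟨⟨i / b, Nat.div_lt_of_lt_mul i.isLt⟩, Finset.mem_univ _, Fin.ext ?_⟩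
    simp only [← hi]
    exact Nat.div_add_mod _ _

/-- One factor of the class `MM^*` realizes any permutation. -/
theorem exists_monarchStar_of_perm (hb : 0 < b) (hN : N = b * p) (σ : Equiv.Perm (Fin N)) :
    ∃ A ∈ monarchStarClass 𝕜 b N, ∀ (x : Fin N → 𝕜) i, (A *ᵥ x) i = x (σ i) := by
  have hσ : ∀ c : Fin b, (Finset.univ.filter fun i : Fin N =>
      (⟨(σ i : ℕ) % b, Nat.mod_lt _ hb⟩ : Fin b) = c).card = p := fun c => by
    rw [← card_filter_mod_eq hb hN c]
    exact Finset.card_equiv σ (by simp)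
  -- Vertices are columns, edges are coordinates, colours are rows.
  obtain ⟨ρ, hρ, h₁, h₂⟩ := exists_bipartite_edge_coloring
    (fun i : Fin N => (⟨(i : ℕ) % b, Nat.mod_lt _ hb⟩ : Fin b))
    (fun i : Fin N => (⟨(σ i : ℕ) % b, Nat.mod_lt _ hb⟩ : Fin b)) p Finset.univ
    (card_filter_mod_eq hb hN) hσ
  simp only [Finset.mem_univ, true_implies, Fin.mk.injEq] at hρ h₁ h₂
  exact exists_monarchStar_of_route hb hN (q := id) ρ hρ Function.injective_id
    (fun k l h h' => congrArg σ (h₁ k l h h')) (fun k l h h' => congrArg σ (h₂ k l h h'))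

/-- One factor of the class `MM^*` realizes any injective partial assignment of coordinates. -/
theorem exists_monarchStar_of_iff (hb : 0 < b) (hN : N = b * p) {ι : Type*} {q f : ι → Fin N}
    (h : ∀ k l, q k = q l ↔ f k = f l) :
    ∃ A ∈ monarchStarClass 𝕜 b N, ∀ (x : Fin N → 𝕜) k, (A *ᵥ x) (q k) = x (f k) := by
  have hext : ∀ k, Function.extend q f id (q k) = f k :=
    fun k => Function.FactorsThrough.extend_apply (fun k l hkl => (h k l).1 hkl) _ k
  obtain ⟨σ, hσ⟩ : ∃ σ : Equiv.Perm (Fin N), ∀ k, σ (q k) = f k := by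
    obtain ⟨g, hg⟩ := Set.MapsTo.exists_equiv_extend_of_card_eq (s := Set.range q)
      (t := (Finset.univ : Finset (Fin N))) (f := Function.extend q f id)
      (by simp) (by intro; simp) (by
        rintro _ ⟨k, rfl⟩ _ ⟨l, rfl⟩ hkl
        rw [hext, hext] at hkl
        exact (h k l).2 hkl)
    refine ⟨g.trans (Equiv.subtypeUnivEquiv fun i => Finset.mem_univ i), fun k => ?_⟩
    have := hg (q k) ⟨k, rfl⟩
    rw [hext] at this
    exact this
  obtain ⟨A, hA, hAx⟩ := exists_monarchStar_of_perm (𝕜 := 𝕜) hb hN σ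
  exact ⟨A, hA, fun x k => by rw [hAx, hσ]⟩

/-- `A` is a product of `w` matrices of the class `MM^*`. -/
def IsMonarchProduct (b : ℕ) (w : ℕ) (A : Matrix (Fin N) (Fin N) 𝕜) : Prop :=
  ∃ l : List (Matrix (Fin N) (Fin N) 𝕜),
    l.length = w ∧ (∀ B ∈ l, B ∈ monarchStarClass 𝕜 b N) ∧ A = l.prod

theorem IsMonarchProduct.of_mem {A : Matrix (Fin N) (Fin N) 𝕜} (h : A ∈ monarchStarClass 𝕜 b N) :
    IsMonarchProduct b 1 A :=
  ⟨[A], rfl, by simpa using h, by simp⟩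

theorem IsMonarchProduct.mul {w w' : ℕ} {A A' : Matrix (Fin N) (Fin N) 𝕜}
    (h : IsMonarchProduct b w A) (h' : IsMonarchProduct b w' A') :
    IsMonarchProduct b (w + w') (A * A') := by
  obtain ⟨l, rfl, hl, rfl⟩ := h
  obtain ⟨l', rfl, hl', rfl⟩ := h'
  refine ⟨l ++ l', List.length_append, fun B hB => ?_, List.prod_append.symm⟩
  exact (List.mem_append.1 hB).elim (hl B) (hl' B)

theorem IsMonarchProduct.pow {w : ℕ} {A : Matrix (Fin N) (Fin N) 𝕜}
    (h : IsMonarchProduct b w A) (k : ℕ) : IsMonarchProduct b (w * k) (A ^ k) := by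
  induction k with
  | zero => exact ⟨[], rfl, by simp, by simp⟩
  | succ k ih =>
    rw [pow_succ, mul_add, mul_one]
    exact ih.mul h

/-- Positions fill the grid column by column, leaving row 0 free; by `hconv`, indices sharing a
leader form runs. Inside the leader's column a value uses the leader's own row; to reach later
columns it uses row 0. No clash occurs there: at most one run leaves a column on the right, and at
most one enters it from the left. -/
theorem exists_fanout_monarchStar (hb : 0 < b) (hN : N = b * (p + 1)) {lead : Fin m → Fin m}
    {pos : Fin m → Fin N} (hm : m ≤ b * p)
    (hpos : ∀ k, (pos k : ℕ) = b * (k % p + 1) + k / p)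
    (hlead : ∀ k, lead k ≤ k)
    (hconv : ∀ k l, lead k ≤ lead l → lead l ≤ k → lead k = lead l) :
    ∃ A ∈ monarchStarClass 𝕜 b N, ∀ (x : Fin N → 𝕜) k, (A *ᵥ x) (pos k) = x (pos (lead k)) := by
  have hp : ∀ _ : Fin m, 0 < p := fun k => by
    rcases Nat.eq_zero_or_pos p with h | h
    · have := k.isLt; subst h; omega
    · exact h
  have hcol : ∀ k : Fin m, (k : ℕ) / p < b := fun k =>
    Nat.div_lt_of_lt_mul (by have := k.isLt; rw [mul_comm]; omega)
  have hmod : ∀ k, (pos k : ℕ) % b = k / p := fun k => by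
    rw [hpos, Nat.mul_add_mod, Nat.mod_eq_of_lt (hcol k)]
  have ext : ∀ k l : Fin m, (k : ℕ) / p = l / p → (k : ℕ) % p = l % p → k = l :=
    fun k l h h' => Fin.ext (by rw [← Nat.div_add_mod (k : ℕ) p, h, h', Nat.div_add_mod])
  have conv : ∀ k l, lead k ≤ l → lead l ≤ k → lead k = lead l := fun k l h h' => by
    rcases le_total (lead k) (lead l) with h1 | h1
    · exact hconv k l h1 h'
    · exact (hconv l k h1 h).symm
  have le : ∀ k l : Fin m, (k : ℕ) / p < l / p → k ≤ l := fun k l h => by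
    by_contra hlt
    exact absurd (Nat.div_le_div_right (c := p) (le_of_not_ge hlt : (l : ℕ) ≤ k)) (by omega)
  have dle : ∀ k, (lead k : ℕ) / p ≤ k / p := fun k => Nat.div_le_div_right (hlead k)
  refine exists_monarchStar_of_route hb hN
    (fun k => if (lead k : ℕ) / p = k / p then lead k % p + 1 else 0) ?_ ?_ ?_ ?_
  · intro k
    have := Nat.mod_lt (lead k : ℕ) (hp k)
    split_ifs <;> omega
  · intro k l h
    refine ext k l (by rw [← hmod k, h, hmod]) ?_
    have h' : (pos k : ℕ) / b = pos l / b := by rw [h]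
    rw [hpos, hpos, Nat.mul_add_div hb, Nat.mul_add_div hb, Nat.div_eq_of_lt (hcol k),
      Nat.div_eq_of_lt (hcol l)] at h'
    omega
  · intro k l h hρ
    rw [hmod, hmod] at h
    have h1 := dle k
    have h2 := dle l
    congr 1
    split_ifs at hρ with h3 h4 h4
    · exact ext _ _ (by omega) (by omega)
    · exact conv k l (le _ _ (by omega)) (le _ _ (by omega))
  · intro k l h hρ
    rw [hmod, hmod] at h
    have h1 := dle k
    have h2 := dle l
    congr 1
    split_ifs at hρ with h3 h4 h4
    · exact ext _ _ (by omega) (by omega)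
    · exact conv k l (le _ _ (by omega)) (le _ _ (by omega))

/-- Three factors realize any assignment of at most `N - b` coordinates, with arbitrary fan-out. -/
theorem exists_monarchProduct_of_injective (hb : 0 < b) (hN : N = b * (p + 1)) (hm : m ≤ b * p)
    {q : Fin m → Fin N} (hq : Function.Injective q) (f : Fin m → Fin N) :
    ∃ A, IsMonarchProduct b 3 A ∧ ∀ (x : Fin N → 𝕜) k, (A *ᵥ x) (q k) = x (f k) := by
  have hp : ∀ _ : Fin m, 0 < p := fun k => by
    rcases Nat.eq_zero_or_pos p with h | h
    · have := k.isLt; subst h; omega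
    · exact h
  have hcol : ∀ k : Fin m, (k : ℕ) / p < b := fun k =>
    Nat.div_lt_of_lt_mul (by have := k.isLt; rw [mul_comm]; omega)
  -- Sorting by source turns the requests for one coordinate into a run; `lead k` is the first index
  -- of the run of `k`.
  let τ := Tuple.sort f
  have hmono : Monotone (f ∘ τ) := Tuple.monotone_sort f
  have hex : ∀ k, ∃ k₀, f (τ k₀) = f (τ k) ∧ ∀ j, f (τ j) = f (τ k) → k₀ ≤ j := fun k => by
    obtain ⟨k₀, h, hmin⟩ := WellFounded.has_min (wellFounded_lt (α := Fin m))
      {j | f (τ j) = f (τ k)} ⟨k, rfl⟩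
    exact ⟨k₀, h, fun j hj => not_lt.1 (hmin j hj)⟩
  choose lead hlead hmin using hex
  have leadEq : ∀ k l, f (τ k) = f (τ l) → lead k = lead l := fun k l h =>
    le_antisymm (hmin k _ ((hlead l).trans h.symm)) (hmin l _ ((hlead k).trans h))
  have lt : ∀ k : Fin m, b * ((k : ℕ) % p + 1) + k / p < N := fun k => by
    have h1 := hcol k
    have h2 : b * ((k : ℕ) % p + 1) ≤ b * p := Nat.mul_le_mul_left b (Nat.mod_lt _ (hp k))
    rw [hN, mul_add b p]
    omega
  let pos : Fin m → Fin N := fun k => ⟨b * (k % p + 1) + k / p, lt k⟩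
  have posInj : Function.Injective pos := fun k l h => by
    have h1 : b * ((k : ℕ) % p + 1) + k / p = b * (l % p + 1) + l / p := congrArg Fin.val h
    have h2 := congrArg (· % b) h1
    have h3 := congrArg (· / b) h1
    simp only [Nat.mul_add_mod, Nat.mul_add_div hb, Nat.div_eq_of_lt (hcol _),
      Nat.mod_eq_of_lt (hcol _)] at h2 h3
    have h4 : (k : ℕ) % p = l % p := by omega
    exact Fin.ext (by rw [← Nat.div_add_mod (k : ℕ) p, h2, h4, Nat.div_add_mod])
  obtain ⟨A₁, h₁, hx₁⟩ := exists_monarchStar_of_iff (𝕜 := 𝕜) hb hN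
    (q := fun k => pos (lead k)) (f := fun k => f (τ k))
    (fun k l => ⟨fun h => by rw [← hlead k, posInj h, hlead l], fun h => by rw [leadEq k l h]⟩)
  obtain ⟨A₂, h₂, hx₂⟩ := exists_fanout_monarchStar (𝕜 := 𝕜) hb hN (lead := lead) (pos := pos) hm
    (fun _ => rfl) (fun k => hmin k k rfl) (fun k l h h' => leadEq k l <| by
      have e1 : f (τ (lead k)) ≤ f (τ (lead l)) := hmono h
      have e2 : f (τ (lead l)) ≤ f (τ k) := hmono h'
      rw [hlead] at e1 e2
      rw [hlead] at e1
      exact le_antisymm e1 e2)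
  obtain ⟨A₃, h₃, hx₃⟩ := exists_monarchStar_of_iff (𝕜 := 𝕜) hb hN
    (q := q) (f := fun k => pos (τ.symm k))
    (fun k l => by rw [hq.eq_iff, posInj.eq_iff, τ.symm.injective.eq_iff])
  refine ⟨A₃ * A₂ * A₁, ((IsMonarchProduct.of_mem h₃).mul (.of_mem h₂)).mul (.of_mem h₁),
    fun x k => ?_⟩
  rw [← Matrix.mulVec_mulVec, ← Matrix.mulVec_mulVec, hx₃, hx₂, hx₁, Equiv.apply_symm_apply]

/-- Four factors combine pairs of coordinates linearly; coordinate `g` is stored in cell `2 * g`. -/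
theorem exists_monarchProduct_combine {S : ℕ} (hb : 0 < b) (h2 : 2 ∣ b) (hN : N = b * (p + 1))
    (hS : 2 * S ≤ b * p) {cell : Fin S → Fin N} (hcell : ∀ g, (cell g : ℕ) = 2 * g)
    (l r : Fin S → Fin S) (α β : Fin S → 𝕜) :
    ∃ A, IsMonarchProduct b 4 A ∧ ∀ (x : Fin N → 𝕜) g,
      (A *ᵥ x) (cell g) = α g * x (cell (l g)) + β g * x (cell (r g)) := by
  have hSN : 2 * S ≤ N := by rw [hN, mul_add b p]; omega
  have half : ∀ k : Fin (2 * S), (k : ℕ) / 2 < S := fun k => by have := k.isLt; omega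
  obtain ⟨A, hA, hx⟩ := exists_monarchProduct_of_injective (𝕜 := 𝕜) hb hN hS
    (q := Fin.castLE hSN) (Fin.castLE_injective hSN)
    (fun k => if (k : ℕ) % 2 = 0 then cell (l ⟨k / 2, half k⟩) else cell (r ⟨k / 2, half k⟩))
  let next : Fin S → Fin N := fun g => ⟨2 * g + 1, by have := g.isLt; omega⟩
  let B : Matrix (Fin N) (Fin N) 𝕜 := fun i j =>
    if h : (i : ℕ) / 2 < S then
      if j = cell ⟨i / 2, h⟩ then α ⟨i / 2, h⟩ else if j = next ⟨i / 2, h⟩ then β ⟨i / 2, h⟩ else 0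
    else 0
  have hB : B ∈ blockDiagClass 𝕜 b N := by
    intro i j hij
    -- As `b` is even, coordinates `2 * g` and `2 * g + 1` share a block.
    have hdiv : (i : ℕ) / 2 ≠ j / 2 := fun h => hij <| by
      obtain ⟨c, rfl⟩ := h2
      rw [← Nat.div_div_eq_div_mul, h, Nat.div_div_eq_div_mul]
    simp only [B, Fin.ext_iff, hcell, next]
    split_ifs <;> first | rfl | omega
  refine ⟨1 * B * 1 * A, (IsMonarchProduct.of_mem (mul_mul_mem_monarchStarClass
    one_mem_diagBlockClass hB one_mem_diagBlockClass)).mul hA, fun x g => ?_⟩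
  have e1 : (A *ᵥ x) (cell g) = x (cell (l g)) := by
    have := hx x ⟨2 * g, by have := g.isLt; omega⟩
    simp only [Nat.mul_mod_right, if_true, Nat.mul_div_cancel_left (g : ℕ) two_pos] at this
    rw [← this]
    exact congrArg _ (Fin.ext (hcell g))
  have e2 : (A *ᵥ x) (next g) = x (cell (r g)) := by
    have := hx x ⟨2 * g + 1, by have := g.isLt; omega⟩
    have h3 : (2 * (g : ℕ) + 1) % 2 ≠ 0 := by omega
    have h4 : (2 * (g : ℕ) + 1) / 2 = g := by omega
    simp only [if_neg h3, h4] at this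
    exact this
  have hg : ((cell g : Fin N) : ℕ) / 2 = g := by rw [hcell]; omega
  have hne : next g ≠ cell g := fun h => by
    have := congrArg Fin.val h
    rw [hcell] at this
    simp only [next] at this
    omega
  have hrow : ∀ j, B (cell g) j = if j = cell g then α g else if j = next g then β g else 0 :=
    fun j => by simp only [B, hg, g.isLt, dif_pos]
  rw [one_mul, mul_one, ← Matrix.mulVec_mulVec, Matrix.mulVec, dotProduct,
    Finset.sum_eq_add (cell g) (next g) hne.symm]
  · rw [hrow, hrow, if_pos rfl, if_neg hne, if_pos rfl, e1, e2]
  · intro j _ hj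
    rw [hrow, if_neg hj.1, if_neg hj.2, zero_mul]
  · simp
  · simp

end Monarch

/-! ### Parallel evaluation of circuits. -/

namespace LinearCircuit

/-- One parallel evaluation step of all the gates at once. -/
theorem exists_step {𝕜 : Type*} [Semiring 𝕜] {n m : ℕ} (C : LinearCircuit 𝕜 n m) :
    ∃ (l r : Fin (n + C.inner) → Fin (n + C.inner)) (α β : Fin (n + C.inner) → 𝕜),
      ∀ (v : Fin n → 𝕜) (t : ℕ) (y : Fin (n + C.inner) → 𝕜),
        (∀ i : Fin (n + C.inner), (i : ℕ) < n ∨ C.gateDepth i ≤ t → y i = C.gateVal v i) →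
        ∀ i, C.gateDepth i ≤ t + 1 → α i * y (l i) + β i * y (r i) = C.gateVal v i := by
  have hk : ∀ i : Fin (n + C.inner), ¬ (i : ℕ) < n → (i : ℕ) - n < C.inner := fun i h => by
    have := i.isLt; omega
  refine ⟨
    fun i => if h : (i : ℕ) < n then i else ⟨C.left ⟨i - n, hk i h⟩, by
      have := C.left_lt ⟨i - n, hk i h⟩; simp only at this; omega⟩,
    fun i => if h : (i : ℕ) < n then i else ⟨C.right ⟨i - n, hk i h⟩, by
      have := C.right_lt ⟨i - n, hk i h⟩; simp only at this; omega⟩,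
    fun i => if h : (i : ℕ) < n then 1 else C.leftCoeff ⟨i - n, hk i h⟩,
    fun i => if h : (i : ℕ) < n then 0 else C.rightCoeff ⟨i - n, hk i h⟩,
    fun v t y hy i hi => ?_⟩
  by_cases h : (i : ℕ) < n
  · simp only [dif_pos h, one_mul, zero_mul, add_zero]
    exact hy i (Or.inl h)
  · rw [gateDepth, dif_neg h] at hi
    rw [gateVal, dif_neg h]
    simp only [dif_neg h]
    rw [hy _ (Or.inr _), hy _ (Or.inr _)]
    · have := (le_max_right _ _).trans (Nat.le_of_add_le_add_left (add_comm t 1 ▸ hi))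
      exact this
    · have := (le_max_left _ _).trans (Nat.le_of_add_le_add_left (add_comm t 1 ▸ hi))
      exact this

/-- Products of monarch matrices evaluate linear circuits. -/
theorem exists_monarchProduct {𝕜 : Type*} [RCLike 𝕜] {n b p N : ℕ} (C : LinearCircuit 𝕜 n n)
    (hb : 0 < b) (h2 : 2 ∣ b) (hN : N = b * (p + 1)) (hS : 2 * (n + C.inner) ≤ b * p)
    (hnN : n ≤ N) :
    ∃ A : Matrix (Fin N) (Fin N) 𝕜, IsMonarchProduct b (3 + 4 * C.depth + 3) A ∧
      ∀ x j, (A *ᵥ x) (Fin.castLE hnN j) =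
        C.gateVal (fun i => x (Fin.castLE hnN i)) (C.out j) := by
  have hSN : 2 * (n + C.inner) ≤ N := by rw [hN, mul_add b p]; omega
  let cell : Fin (n + C.inner) → Fin N := fun g => ⟨2 * g, by have := g.isLt; omega⟩
  have cellInj : Function.Injective cell := fun g g' h => by
    have : 2 * (g : ℕ) = 2 * g' := congrArg Fin.val h
    exact Fin.ext (by omega)
  obtain ⟨l, r, α, β, hstep⟩ := C.exists_step
  obtain ⟨A₀, hA₀, hx₀⟩ := exists_monarchProduct_of_injective (𝕜 := 𝕜) hb hN (by omega)
    (cellInj.comp (Fin.castAdd_injective n C.inner)) (Fin.castLE hnN)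
  obtain ⟨A₁, hA₁, hx₁⟩ := exists_monarchProduct_combine (𝕜 := 𝕜) hb h2 hN hS (cell := cell)
    (fun _ => rfl) l r α β
  obtain ⟨A₂, hA₂, hx₂⟩ := exists_monarchProduct_of_injective (𝕜 := 𝕜) hb hN (by omega)
    (Fin.castLE_injective hnN) (fun j => cell (C.out j))
  refine ⟨A₂ * A₁ ^ C.depth * A₀, (hA₂.mul (hA₁.pow _)).mul hA₀, fun x j => ?_⟩
  have hdepth : ∀ i : Fin (n + C.inner), (i : ℕ) < n → C.gateDepth i = 0 := fun i hi => by
    rw [gateDepth, dif_pos hi]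
  have hpos : ∀ i : Fin (n + C.inner), C.gateDepth i ≤ 0 → (i : ℕ) < n := fun i hi => by
    by_contra h
    rw [gateDepth, dif_neg h] at hi
    exact absurd ((Nat.le_add_right 1 _).trans hi) (by norm_num)
  -- Cells of gates deeper than `t` may hold arbitrary values.
  have inv : ∀ t i, C.gateDepth i ≤ t → ((A₁ ^ t * A₀) *ᵥ x) (cell i) =
      C.gateVal (fun i => x (Fin.castLE hnN i)) i := by
    intro t
    induction t with
    | zero =>
      intro i hi
      have h := hpos i hi
      rw [pow_zero, one_mul, gateVal, dif_pos h]
      exact hx₀ x ⟨i, h⟩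
    | succ t ih =>
      intro i hi
      rw [pow_succ', mul_assoc, ← Matrix.mulVec_mulVec, hx₁]
      refine hstep _ t (fun i => ((A₁ ^ t * A₀) *ᵥ x) (cell i)) (fun i hi => ih i ?_) i hi
      rcases hi with h | h
      · rw [hdepth i h]; omega
      · exact h
  rw [mul_assoc, ← Matrix.mulVec_mulVec, hx₂]
  exact inv _ _ (Finset.le_sup (f := fun j => C.gateDepth (C.out j)) (Finset.mem_univ j))

end LinearCircuit

/-! ### Choice of parameters and the hierarchy bound. -/

theorem mainTheorem5 :
    ∃ K : ℝ, ∀ (𝕜 : Type*) [RCLike 𝕜] (n b d s : ℕ) (M : Matrix (Fin n) (Fin n) 𝕜)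
      (C : LinearCircuit 𝕜 n n),
      C.Computes M → C.depth ≤ d → 1 ≤ d → C.size ≤ s →
      1 < b → b < n → (∃ k : ℕ, b = 2 ^ k) → b ∣ n →
      ∃ w e : ℕ, (w : ℝ) ≤ K * d ∧ (e : ℝ) ≤ K * ((s : ℝ) / n) ∧
        M ∈ monarchHierarchy 𝕜 b n w e := by
  -- Since `1 ≤ d`, the width `3 + 4 * C.depth + 3` is at most `10 * d`.
  refine ⟨10, ?_⟩
  intro 𝕜 _ n b d s M C hC hd hd1 hs hb hbn hk hdvd
  obtain ⟨k, hk⟩ := hk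
  have h2 : 2 ∣ b := by
    rw [hk]
    exact dvd_pow_self 2 (fun h => by rw [hk, h] at hb; omega)
  obtain ⟨c, hndef⟩ := hdvd
  have hn : 0 < n := by omega
  have hc : 0 < c := Nat.pos_of_ne_zero fun h => by simp [h] at hndef; omega
  have hsz : C.size = n + C.inner := rfl
  -- Two cells per gate plus a spare row of length `b < n ≤ C.size` fit into `4 * C.size ≤ e * n`;
  -- also `e * n ≤ 8 * s`.
  set e := 4 * (C.size / n + 1) with he
  have he1 : 1 ≤ e := Nat.mul_pos (by norm_num) (Nat.succ_pos _)
  have hen : 4 * C.size ≤ e * n := by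
    have := Nat.lt_div_mul_add (a := C.size) hn
    rw [he, mul_assoc, add_mul, one_mul]
    omega
  have hec : 0 < e * c := Nat.mul_pos (by omega) hc
  obtain ⟨p, hp⟩ : ∃ p, e * c = p + 1 := ⟨e * c - 1, by omega⟩
  have hN : e * n = b * (p + 1) := by rw [← hp, hndef]; ring
  have hS : 2 * (n + C.inner) ≤ b * p := by
    have := hN
    rw [mul_add b p] at this
    omega
  have hle := Nat.le_mul_of_pos_left n he1
  obtain ⟨A, ⟨l, hl, hmem, hprod⟩, hA⟩ := C.exists_monarchProduct (by omega) h2 hN hS hle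
  refine ⟨3 + 4 * C.depth + 3, e, ?_, ?_, ?_⟩
  · have : 3 + 4 * C.depth + 3 ≤ 10 * d := by omega
    exact_mod_cast this
  · rw [← mul_div_assoc, le_div_iff₀ (by exact_mod_cast hn)]
    have h1 : C.size / n * n ≤ C.size := Nat.div_mul_le_self _ _
    have : e * n ≤ 10 * s := by
      rw [he, mul_assoc, add_mul, one_mul]
      omega
    exact_mod_cast this
  · refine ⟨he1, fun k => l.get (k.cast hl.symm), fun k => hmem _ (List.get_mem _ _), ?_⟩
    have hof : List.ofFn (fun k : Fin (3 + 4 * C.depth + 3) => l.get (k.cast hl.symm)) = l := by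
      clear hmem hprod
      generalize 3 + 4 * C.depth + 3 = w at hl
      subst hl
      exact List.ofFn_get l
    rw [hof, ← hprod]
    ext i j
    have h := hA (Pi.single (Fin.castLE hle j) 1) i
    have hv : (fun i' => (Pi.single (Fin.castLE hle j) 1 : Fin (e * n) → 𝕜) (Fin.castLE hle i')) =
        Pi.single j 1 := by
      ext i'
      simp [Pi.single_apply, Fin.ext_iff]
    rw [hv, congrFun (hC (Pi.single j 1)) i] at h
    simpa using h.symm
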